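/- Conventions. A \emph{Stone space} is a compact Hausdorff totally disconnected space. Relations $R\colon X\to Y$ are subsets of $X\times Y$; $S\circ R$ is relation composition, $\breve R$ the converse, $R[F]$ the image of $F$; functions are identified with their graphs. $R$ is \emph{closed} if it is closed in $X\times Y$. An \emph{allegory} is a category whose hom-sets are partially ordered with binary meets, with composition monotone in both arguments, together with a contravariant, identity-on-objects, involutive, order-preserving operation $(-)^\dagger$ on morphisms (compatible with identities and composition), such that $gf\wedge h\le (g\wedge hf^\dagger)f$ for all $f\colon C\to D$, $g\colon D\to E$, $h\colon C\to E$. A \emph{morphism of allegories} is a functor preserving binary meets of morphisms and $(-)^\dagger$; it is an \emph{equivalence of allegories} if it is also an equivalence of categories. Let $\mathsf{KHaus}^{\mathsf R}$ be the category of compact Hausdorff spaces and closed relations. Let $\mathsf{StoneE}^{\mathsf R}$ be the category whose objects are pairs $(X,E)$ with $X$ a Stone space and $E$ a closed equivalence relation on $X$, whose morphisms $(X,E)\to(X',E')$ are the closed relations $R\colon X\to X'$ with $R\circ E=R=E'\circ R$, with relation composition and with identity $E$ on $(X,E)$; it is an allegory under inclusion and $R^\dagger=\breve R$. A \emph{Gleason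 space} is an object $(X,E)$ of $\mathsf{StoneE}^{\mathsf R}$ such that $X$ is extremally disconnected (closures of open sets are open) and $E$ is irreducible (if $F\subsetneq X$ is a proper closed subset, then so is $E[F]$). Let $\mathsf{Gle}^{\mathsf R}$ be the full subcategory of $\mathsf{StoneE}^{\mathsf R}$ of Gleason spaces, with the inherited allegory structure. Let $\mathcal Q\colon\mathsf{StoneE}^{\mathsf R}\to\mathsf{KHaus}^{\mathsf R}$ be the functor with $\mathcal Q(X,E)=X/E$ and $\mathcal Q(R)=\pi'\circ R\circ\breve\pi$, where $\pi\colon X\to X/E$ and $\pi'\colon X'\to X'/E'$ are the projections. For a compact Hausdorff space $X$ let $g_X\colon\widehat X\to X$ be its Gleason cover: $\widehat X$ is the space of ultrafilters of the Boolean algebra of regular open subsets of $X$, and $g_X$ sends an ultrafilter to its limit, i.e. to the unique point in the closure of all its members. Let $\mathcal G\colon\mathsf{KHaus}^{\mathsf R}\to\mathsf{StoneE}^{\mathsf R}$ be the functor with $\mathcal G(X)=(\widehat X,E)$, where $x\mathrel E y$ iff $g_X(x)=g_X(y)$, and $\mathcal G(R)=\breve g_{X'}\circ R\circ g_X$ for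 $R\colon X\to X'$. Theorem. For each object $(X,E)$ of $\mathsf{StoneE}^{\mathsf R}$, $\mathcal G(X/E)$ is a Gleason space and $(X,E)$ is isomorphic to $\mathcal G(X/E)$ in $\mathsf{StoneE}^{\mathsf R}$. The functor $\mathcal G$ is a quasi-inverse of $\mathcal Q$, that is, $\mathcal G\circ\mathcal Q\cong\mathrm{id}_{\mathsf{StoneE}^{\mathsf R}}$ and $\mathcal Q\circ\mathcal G\cong\mathrm{id}_{\mathsf{KHaus}^{\mathsf R}}$ naturally; moreover $\mathcal G$ takes values in $\mathsf{Gle}^{\mathsf R}$ and, as a functor $\mathsf{KHaus}^{\mathsf R}\to\mathsf{Gle}^{\mathsf R}$, it is a quasi-inverse of the restriction of $\mathcal Q$ to $\mathsf{Gle}^{\mathsf R}$. The inclusion $\mathsf{Gle}^{\mathsf R}\hookrightarrow\mathsf{StoneE}^{\mathsf R}$ is an equivalence of allegories. -/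

import Mathlib

open CategoryTheory TopologicalSpace
open scoped SetRel

universe u v w

/-! ## Allegories -/

/-- An allegory: a category whose hom-sets are partially ordered with binary meets, such that
composition is monotone in both arguments, together with an order-preserving, identity-on-objects
contravariant involution (the dagger), satisfying the modular law.
(`f ≫ g` is the composite written `g f` in the usual notation.) -/
class Allegory (A : Type w) [Category.{v} A] where
  homSemilatticeInf : ∀ X Y : A, SemilatticeInf (X ⟶ Y)
  comp_mono : ∀ {X Y Z : A} {f f' : X ⟶ Y} {g g' : Y ⟶ Z},
    f ≤ f' → g ≤ g' → f ≫ g ≤ f' ≫ g'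
  dagger : ∀ {X Y : A}, (X ⟶ Y) → (Y ⟶ X)
  dagger_id : ∀ X : A, dagger (𝟙 X) = 𝟙 X
  dagger_comp : ∀ {X Y Z : A} (f : X ⟶ Y) (g : Y ⟶ Z), dagger (f ≫ g) = dagger g ≫ dagger f
  dagger_dagger : ∀ {X Y : A} (f : X ⟶ Y), dagger (dagger f) = f
  dagger_mono : ∀ {X Y : A} {f g : X ⟶ Y}, f ≤ g → dagger f ≤ dagger g
  modular : ∀ {X Y Z : A} (f : X ⟶ Y) (g : Y ⟶ Z) (h : X ⟶ Z),
    (f ≫ g) ⊓ h ≤ f ≫ (g ⊓ (dagger f ≫ h))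

attribute [reducible, instance] Allegory.homSemilatticeInf

/-- A functor between allegories is a morphism of allegories if it preserves binary meets of
morphisms and commutes with the dagger. -/
structure IsAllegoryMorphism {A : Type*} [Category A] [Allegory A] {B : Type*} [Category B]
    [Allegory B] (F : A ⥤ B) : Prop where
  map_inf : ∀ {X Y : A} (f g : X ⟶ Y), F.map (f ⊓ g) = F.map f ⊓ F.map g
  map_dagger : ∀ {X Y : A} (f : X ⟶ Y), F.map (Allegory.dagger f) = Allegory.dagger (F.map f)

/-- An equivalence of allegories is a morphism of allegories that is an equivalence of
categories. -/
structure IsAllegoryEquivalence {A : Type*} [Category A] [Allegory A] {B : Type*} [Category B]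
    [Allegory B] (F : A ⥤ B) : Prop where
  isAllegoryMorphism : IsAllegoryMorphism F
  isEquivalence : F.IsEquivalence

/-- Two functors in opposite directions are quasi-inverse to each other if both composites are
naturally isomorphic to the identity functors. -/
def IsQuasiInverse {A : Type*} [Category A] {B : Type*} [Category B] (G : B ⥤ A) (F : A ⥤ B) :
    Prop :=
  Nonempty (F ⋙ G ≅ 𝟭 A) ∧ Nonempty (G ⋙ F ≅ 𝟭 B)

/-- A full subcategory of an allegory, with the inherited order, meets and dagger. -/
instance fullSubcategoryAllegory {A : Type w} [Category.{v} A] [Allegory A]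
    (P : ObjectProperty A) : Allegory P.FullSubcategory where
  homSemilatticeInf X Y :=
    { le := fun f g => f.hom ≤ g.hom
      le_refl := fun f => le_refl f.hom
      le_trans := fun f g h h₁ h₂ => le_trans (a := f.hom) (b := g.hom) (c := h.hom) h₁ h₂
      le_antisymm := fun f g h₁ h₂ => P.hom_ext (le_antisymm (a := f.hom) (b := g.hom) h₁ h₂)
      inf := fun f g => P.homMk (f.hom ⊓ g.hom)
      inf_le_left := fun f g => inf_le_left (a := f.hom) (b := g.hom)
      inf_le_right := fun f g => inf_le_right (a := f.hom) (b := g.hom)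
      le_inf := fun f g h h₁ h₂ => (le_inf h₁ h₂ : f.hom ≤ g.hom ⊓ h.hom) }
  comp_mono h₁ h₂ := Allegory.comp_mono (A := A) h₁ h₂
  dagger f := P.homMk (Allegory.dagger f.hom)
  dagger_id X := P.hom_ext (Allegory.dagger_id X.obj)
  dagger_comp f g := P.hom_ext (Allegory.dagger_comp f.hom g.hom)
  dagger_dagger f := P.hom_ext (Allegory.dagger_dagger f.hom)
  dagger_mono h := Allegory.dagger_mono (A := A) h
  modular f g h := Allegory.modular f.hom g.hom h.hom

/-! ## Closed relations -/

/-- Closed relations compose when the middle space is compact. -/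
theorem isClosed_setRel_comp {X Y Z : Type*} [TopologicalSpace X] [TopologicalSpace Y]
    [TopologicalSpace Z] [CompactSpace Y] {R : SetRel X Y} {S : SetRel Y Z}
    (hR : IsClosed (R : Set (X × Y))) (hS : IsClosed (S : Set (Y × Z))) :
    IsClosed (R ○ S : Set (X × Z)) := by
  have h1 : IsClosed {p : Y × (X × Z) | (p.2.1, p.1) ∈ R ∧ (p.1, p.2.2) ∈ S} :=
    (hR.preimage (by fun_prop : Continuous fun p : Y × (X × Z) => (p.2.1, p.1))).inter
      (hS.preimage (by fun_prop : Continuous fun p : Y × (X × Z) => (p.1, p.2.2)))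
  have h2 := isClosedMap_snd_of_compactSpace _ h1
  convert h2 using 1
  ext ⟨x, z⟩
  simp [SetRel.mem_comp]

theorem isClosed_setRel_inv {X Y : Type*} [TopologicalSpace X] [TopologicalSpace Y]
    {R : SetRel X Y} (hR : IsClosed (R : Set (X × Y))) : IsClosed (R.inv : Set (Y × X)) :=
  hR.preimage continuous_swap

/-- The modular law for relations. -/
theorem setRel_modular {X Y Z : Type*} (R : SetRel X Y) (S : SetRel Y Z) (T : SetRel X Z) :
    (R ○ S) ∩ T ⊆ R ○ (S ∩ (R.inv ○ T)) := by
  rintro ⟨x, z⟩ ⟨⟨y, hxy, hyz⟩, hT⟩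
  exact ⟨y, hxy, hyz, x, hxy, hT⟩

/-! ## Compact Hausdorff spaces and closed relations -/

/-- Objects: compact Hausdorff spaces (the morphisms below are closed relations, not maps). -/
structure KHausR : Type (u + 1) where
  space : CompHaus.{u}

namespace KHausR

/-- A closed relation between compact Hausdorff spaces. -/
@[ext]
structure Hom (X Y : KHausR.{u}) : Type u where
  rel : SetRel X.space Y.space
  isClosed_rel : IsClosed (rel : Set (X.space × Y.space))

/-- Identities are identity relations, composition is relation composition. -/
instance : Category KHausR.{u} where
  Hom := Hom
  id _ := ⟨SetRel.id, isClosed_diagonal⟩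
  comp R S := ⟨R.rel ○ S.rel, isClosed_setRel_comp R.isClosed_rel S.isClosed_rel⟩
  id_comp _ := Hom.ext (SetRel.id_comp _)
  comp_id _ := Hom.ext (SetRel.comp_id _)
  assoc _ _ _ := Hom.ext (SetRel.comp_assoc _ _ _)

end KHausR

/-! ## Stone spaces with a closed equivalence relation -/

/-- Objects: pairs `(X, E)` with `X` a Stone space and `E` a closed equivalence relation
on `X`. -/
structure StoneER : Type (u + 1) where
  space : Profinite.{u}
  setoid : Setoid space
  isClosed_setoid : IsClosed {p : space × space | setoid p.1 p.2}

namespace StoneER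

/-- The equivalence relation of `(X, E)` as a set of pairs. -/
def E (X : StoneER.{u}) : SetRel X.space X.space := {p | X.setoid p.1 p.2}

theorem E_comp_E (X : StoneER.{u}) : X.E ○ X.E = X.E := by
  ext ⟨x, y⟩
  exact ⟨fun ⟨z, h₁, h₂⟩ => X.setoid.trans h₁ h₂, fun h => ⟨x, X.setoid.refl x, h⟩⟩

theorem inv_E (X : StoneER.{u}) : X.E.inv = X.E := by
  ext ⟨x, y⟩
  exact ⟨fun h => X.setoid.symm h, fun h => X.setoid.symm h⟩

/-- A compatible closed relation `R` from `(X, E)` to `(X', E')`: a closed relation with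
`R ∘ E = R = E' ∘ R`. (`A ○ B` is relation composition in diagrammatic order.) -/
@[ext]
structure Hom (X Y : StoneER.{u}) : Type u where
  rel : SetRel X.space Y.space
  isClosed_rel : IsClosed (rel : Set (X.space × Y.space))
  E_comp : X.E ○ rel = rel
  comp_E : rel ○ Y.E = rel

/-- The identity of `(X, E)` is `E`, composition is relation composition. -/
instance : Category StoneER.{u} where
  Hom := Hom
  id X := ⟨X.E, X.isClosed_setoid, X.E_comp_E, X.E_comp_E⟩
  comp R S := ⟨R.rel ○ S.rel, isClosed_setRel_comp R.isClosed_rel S.isClosed_rel,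
    by rw [← SetRel.comp_assoc, R.E_comp], by rw [SetRel.comp_assoc, S.comp_E]⟩
  id_comp R := Hom.ext R.E_comp
  comp_id R := Hom.ext R.comp_E
  assoc _ _ _ := Hom.ext (SetRel.comp_assoc _ _ _)

/-- The intersection of two compatible closed relations. -/
def Hom.inter {X Y : StoneER.{u}} (R S : Hom X Y) : Hom X Y where
  rel := R.rel ∩ S.rel
  isClosed_rel := R.isClosed_rel.inter S.isClosed_rel
  E_comp := by
    apply Set.Subset.antisymm
    · rintro ⟨x, y⟩ ⟨z, hxz, hR, hS⟩
      exact ⟨R.E_comp.subset ⟨z, hxz, hR⟩, S.E_comp.subset ⟨z, hxz, hS⟩⟩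
    · rintro ⟨x, y⟩ h
      exact ⟨x, X.setoid.refl x, h⟩
  comp_E := by
    apply Set.Subset.antisymm
    · rintro ⟨x, y⟩ ⟨z, ⟨hR, hS⟩, hzy⟩
      exact ⟨R.comp_E.subset ⟨z, hR, hzy⟩, S.comp_E.subset ⟨z, hS, hzy⟩⟩
    · rintro ⟨x, y⟩ h
      exact ⟨y, h, Y.setoid.refl y⟩

/-- The converse of a compatible closed relation. -/
def Hom.converse {X Y : StoneER.{u}} (R : Hom X Y) : Hom Y X where
  rel := R.rel.inv
  isClosed_rel := isClosed_setRel_inv R.isClosed_rel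
  E_comp := by rw [← Y.inv_E, ← SetRel.inv_comp, R.comp_E]
  comp_E := by rw [← X.inv_E, ← SetRel.inv_comp, R.E_comp]

/-- The allegory structure: hom-sets ordered by inclusion, the dagger is the converse. -/
instance : Allegory StoneER.{u} where
  homSemilatticeInf X Y :=
    { le := fun R S : Hom X Y => R.rel ⊆ S.rel
      le_refl := fun R => Set.Subset.refl R.rel
      le_trans := fun R S T h₁ h₂ => Set.Subset.trans h₁ h₂
      le_antisymm := fun R S h₁ h₂ => Hom.ext (Set.Subset.antisymm h₁ h₂)
      inf := Hom.inter
      inf_le_left := fun R S => Set.inter_subset_left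
      inf_le_right := fun R S => Set.inter_subset_right
      le_inf := fun R S T h₁ h₂ => Set.subset_inter h₁ h₂ }
  comp_mono h₁ h₂ := SetRel.comp_subset_comp h₁ h₂
  dagger := Hom.converse
  dagger_id X := Hom.ext X.inv_E
  dagger_comp R S := Hom.ext (SetRel.inv_comp _ _)
  dagger_dagger R := rfl
  dagger_mono h := SetRel.inv_mono h
  modular R S T := setRel_modular _ _ _

end StoneER

/-! ## Gleason spaces -/

/-- `(X, E)` is a Gleason space: `X` is extremally disconnected and `E` is irreducible, i.e. if
`F` is a proper closed subset of `X`, then so is the `E`-image `E[F]`. -/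
def IsGleasonSpace : ObjectProperty StoneER.{u} := fun X =>
  ExtremallyDisconnected X.space ∧
    ∀ F : Set X.space, IsClosed F → F ≠ Set.univ →
      IsClosed (X.E.image F) ∧ X.E.image F ≠ Set.univ

/-- The full subcategory of Gleason spaces. -/
abbrev GleR : Type (u + 1) := IsGleasonSpace.{u}.FullSubcategory

/-! ## The quotient functor -/

/-- The quotient of a compact Hausdorff space by a closed equivalence relation is Hausdorff. -/
theorem t2Space_quotient_of_isClosed {X : Type*} [TopologicalSpace X] [CompactSpace X]
    [T2Space X] (s : Setoid X) (hs : IsClosed {p : X × X | s p.1 p.2}) :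
    T2Space (Quotient s) := by
  have hcl : ∀ A : Set X, IsClosed A → IsClosed ((Quotient.mk s) '' A) := by
    intro A hA
    rw [← isQuotientMap_quotient_mk'.isClosed_preimage]
    have h := isClosedMap_snd_of_compactSpace _
      (hs.inter (hA.preimage (continuous_fst : Continuous (Prod.fst : X × X → X))))
    convert h using 1
    ext y
    simp only [Set.mem_preimage, Set.mem_image, Set.mem_inter_iff, Set.mem_ofPred_eq, Prod.exists,
      exists_eq_right]
    exact ⟨fun ⟨x, hx, h⟩ => ⟨x, Quotient.exact h, hx⟩,
      fun ⟨x, h, hx⟩ => ⟨x, hx, Quotient.sound h⟩⟩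
  refine ⟨fun p q hpq => ?_⟩
  obtain ⟨x, rfl⟩ := Quotient.exists_rep p
  obtain ⟨y, rfl⟩ := Quotient.exists_rep q
  have hfib : ∀ z : X, IsClosed (Quotient.mk s ⁻¹' {Quotient.mk s z}) := fun z => by
    have h1 := hcl {z} isClosed_singleton
    rw [Set.image_singleton] at h1
    exact h1.preimage continuous_quotient_mk'
  have hdisj : Disjoint (Quotient.mk s ⁻¹' {Quotient.mk s x})
      (Quotient.mk s ⁻¹' {Quotient.mk s y}) := by
    rw [Set.disjoint_left]
    intro z hz hz'
    exact hpq (hz.symm.trans hz')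
  obtain ⟨U, V, hU, hV, hxU, hyV, hUV⟩ := normal_separation (hfib x) (hfib y) hdisj
  refine ⟨(Quotient.mk s '' Uᶜ)ᶜ, (Quotient.mk s '' Vᶜ)ᶜ, (hcl _ hU.isClosed_compl).isOpen_compl,
    (hcl _ hV.isClosed_compl).isOpen_compl, ?_, ?_, ?_⟩
  · rintro ⟨z, hz, h⟩
    exact hz (hxU h)
  · rintro ⟨z, hz, h⟩
    exact hz (hyV h)
  · rw [Set.disjoint_left]
    intro r hr hr'
    obtain ⟨z, rfl⟩ := Quotient.exists_rep r
    have hzU : z ∈ U := by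
      by_contra hz
      exact hr ⟨z, hz, rfl⟩
    have hzV : z ∈ V := by
      by_contra hz
      exact hr' ⟨z, hz, rfl⟩
    exact Set.disjoint_left.1 hUV hzU hzV

namespace StoneER

/-- The quotient space `X / E`. -/
def quotient (X : StoneER.{u}) : KHausR.{u} :=
  haveI : T2Space (Quotient X.setoid) := t2Space_quotient_of_isClosed X.setoid X.isClosed_setoid
  ⟨CompHaus.of (Quotient X.setoid)⟩

/-- The projection `π : X → X / E`. -/
def proj (X : StoneER.{u}) : X.space → X.quotient.space := Quotient.mk X.setoid

theorem continuous_proj (X : StoneER.{u}) : Continuous X.proj := continuous_quotient_mk'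

theorem proj_surjective (X : StoneER.{u}) : Function.Surjective X.proj := Quotient.exists_rep

theorem proj_eq_iff (X : StoneER.{u}) {x y : X.space} : X.proj x = X.proj y ↔ (x, y) ∈ X.E :=
  Quotient.eq

/-- The relation `π' ∘ R ∘ π˘` from `X / E` to `X' / E'`, where `π˘` is the converse of (the graph
of) `π`. -/
def quotientRel {X Y : StoneER.{u}} (R : X ⟶ Y) : SetRel X.quotient.space Y.quotient.space :=
  {p | ∃ x y, X.proj x = p.1 ∧ (x, y) ∈ R.rel ∧ Y.proj y = p.2}

theorem isClosed_quotientRel {X Y : StoneER.{u}} (R : X ⟶ Y) :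
    IsClosed (quotientRel R : Set (X.quotient.space × Y.quotient.space)) := by
  have h : (quotientRel R : Set (X.quotient.space × Y.quotient.space))
      = (Prod.map X.proj Y.proj) '' R.rel := by
    ext ⟨p, q⟩
    constructor
    · rintro ⟨x, y, hx, h, hy⟩
      exact ⟨(x, y), h, Prod.ext hx hy⟩
    · rintro ⟨⟨x, y⟩, h, he⟩
      exact ⟨x, y, congrArg Prod.fst he, h, congrArg Prod.snd he⟩
  rw [h]
  exact (R.isClosed_rel.isCompact.image
    (X.continuous_proj.prodMap Y.continuous_proj)).isClosed

end StoneER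

/-- The quotient functor `𝒬`, sending `(X, E)` to `X / E` and `R` to `π' ∘ R ∘ π˘`. -/
def quotientFunctor : StoneER.{u} ⥤ KHausR.{u} where
  obj X := X.quotient
  map R := ⟨StoneER.quotientRel R, StoneER.isClosed_quotientRel R⟩
  map_id X := by
    refine KHausR.Hom.ext ?_
    ext ⟨p, q⟩
    constructor
    · rintro ⟨x, y, rfl, h, rfl⟩
      exact X.proj_eq_iff.2 h
    · rintro (rfl : p = q)
      obtain ⟨x, rfl⟩ := X.proj_surjective p
      exact ⟨x, x, rfl, X.setoid.refl x, rfl⟩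
  map_comp {X Y Z} R S := by
    refine KHausR.Hom.ext ?_
    ext ⟨p, q⟩
    constructor
    · rintro ⟨x, z, rfl, ⟨y, h₁, h₂⟩, rfl⟩
      exact ⟨Y.proj y, ⟨x, y, rfl, h₁, rfl⟩, ⟨y, z, rfl, h₂, rfl⟩⟩
    · rintro ⟨r, ⟨x, y, rfl, h₁, rfl⟩, ⟨y', z, hy, h₂, rfl⟩⟩
      have h₃ : (y', y) ∈ Y.E := Y.proj_eq_iff.1 hy
      exact ⟨x, z, rfl, ⟨y, h₁, S.E_comp.subset ⟨y', Y.setoid.symm h₃, h₂⟩⟩, rfl⟩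

/-! ## The Gleason cover

The Gleason cover of a compact Hausdorff space `X` is the Stone space `X̂` of the Boolean algebra of
regular open subsets of `X`, i.e. its space of ultrafilters, with the map `g : X̂ → X` sending an
ultrafilter to its limit. -/

/-- The Boolean algebra of regular open subsets of `X`, i.e. of those open `U` that equal the
interior of their closure. The Heyting complement of an open set is the interior of its set
complement, so `U` is regular open iff `Uᶜᶜ = U`; in this Boolean algebra `U ⊓ V = U ∩ V` and
`Uᶜ` is the interior of the set complement of `U`. -/
abbrev RegularOpens (X : Type u) [TopologicalSpace X] : Type u := Heyting.Regular (Opens X)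

/-- The ultrafilters of the Boolean algebra of regular opens, given by their characteristic
functions with values in the discrete space `Bool`. -/
def regularOpenUltrafilters (X : Type u) [TopologicalSpace X] : Set (RegularOpens X → Bool) :=
  {φ | φ ⊤ = true ∧ (∀ U V, φ (U ⊓ V) = (φ U && φ V)) ∧ ∀ U, φ Uᶜ = !φ U}

/-- The underlying space of the Gleason cover, with the Stone topology, generated by the sets
`{φ | φ U = true}`: this is the subspace topology from the product `RegularOpens X → Bool`. -/
abbrev GleasonCover (X : Type u) [TopologicalSpace X] : Type u := regularOpenUltrafilters X

instance compactSpace_gleasonCover (X : Type u) [TopologicalSpace X] :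
    CompactSpace (GleasonCover X) := by
  have h : IsClosed (regularOpenUltrafilters X) := by
    have h1 : IsClosed {φ : RegularOpens X → Bool | φ ⊤ = true} :=
      isClosed_eq (continuous_apply _) continuous_const
    have h2 : IsClosed (⋂ (U : RegularOpens X) (V : RegularOpens X),
        {φ : RegularOpens X → Bool | φ (U ⊓ V) = (φ U && φ V)}) := by
      refine isClosed_iInter fun U => isClosed_iInter fun V => isClosed_eq (continuous_apply _) ?_
      have hc : Continuous fun φ : RegularOpens X → Bool => (φ U, φ V) :=
        (continuous_apply U).prodMk (continuous_apply V)
      exact (continuous_of_discreteTopology (f := fun b : Bool × Bool => (b.1 && b.2))).comp hc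
    have h3 : IsClosed (⋂ U : RegularOpens X, {φ : RegularOpens X → Bool | φ Uᶜ = !φ U}) := by
      refine isClosed_iInter fun U => isClosed_eq (continuous_apply _) ?_
      exact (continuous_of_discreteTopology (f := fun b : Bool => !b)).comp (continuous_apply U)
    convert h1.inter (h2.inter h3) using 1
    ext φ
    simp [regularOpenUltrafilters]
  exact isCompact_iff_compactSpace.mp h.isCompact

namespace GleasonCover

variable {X : Type u} [TopologicalSpace X]

/-- The set underlying a regular open. -/
abbrev carrier (U : RegularOpens X) : Set X := ((U : Opens X) : Set X)

/-- The Heyting complement of an open set is the interior of its set complement. -/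
theorem coe_opens_compl (V : Opens X) : ((Vᶜ : Opens X) : Set X) = interior (V : Set X)ᶜ := by
  apply Set.Subset.antisymm
  · refine interior_maximal ?_ Vᶜ.isOpen
    intro x hx hx'
    have h : x ∈ Vᶜ ⊓ V := ⟨hx, hx'⟩
    rw [compl_inf_self] at h
    exact h
  · have h : (⟨interior (V : Set X)ᶜ, isOpen_interior⟩ : Opens X) ≤ Vᶜ := by
      rw [le_compl_iff_disjoint_right, disjoint_iff_inf_le]
      intro x hx
      exact (interior_subset hx.1 hx.2).elim
    exact h

theorem carrier_compl (U : RegularOpens X) : carrier Uᶜ = interior (carrier U)ᶜ := by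
  rw [carrier, Heyting.Regular.coe_compl, coe_opens_compl]

/-- The regular open `int (cl V)` generated by an open set `V`. -/
def regularize (V : Opens X) : RegularOpens X := Heyting.Regular.toRegular V

theorem carrier_regularize (V : Opens X) :
    carrier (regularize V) = interior (closure (V : Set X)) := by
  rw [carrier, regularize, Heyting.Regular.coe_toRegular, coe_opens_compl, coe_opens_compl,
    interior_compl, interior_compl, closure_compl, compl_compl]

/-- The ultrafilter `φ` converges to `x`: the point `x` lies in the closure of every member. -/
def ConvergesTo (φ : GleasonCover X) (x : X) : Prop :=
  ∀ U : RegularOpens X, φ.1 U = true → x ∈ closure (carrier U)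

/-- A regular open neighbourhood of a limit of `φ` belongs to `φ`. -/
theorem ConvergesTo.mem {φ : GleasonCover X} {x : X} (h : ConvergesTo φ x) {U : RegularOpens X}
    (hx : x ∈ carrier U) : φ.1 U = true := by
  by_contra hU
  have h1 : φ.1 Uᶜ = true := by
    rw [φ.2.2.2 U]
    simpa using hU
  obtain ⟨y, hy, hy'⟩ := mem_closure_iff.1 (h _ h1) _ U.val.isOpen hx
  rw [carrier_compl] at hy'
  exact interior_subset hy' hy

theorem exists_convergesTo [CompactSpace X] (φ : GleasonCover X) : ∃ x, ConvergesTo φ x := by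
  let t : {U : RegularOpens X // φ.1 U = true} → Set X := fun U => closure (carrier U.1)
  have hne : (⋂ i, t i).Nonempty := by
    have : Nonempty {U : RegularOpens X // φ.1 U = true} := ⟨⟨⊤, φ.2.1⟩⟩
    refine IsCompact.nonempty_iInter_of_directed_nonempty_isCompact_isClosed t ?_ ?_
      (fun i => isClosed_closure.isCompact) (fun i => isClosed_closure)
    · intro U V
      refine ⟨⟨U.1 ⊓ V.1, by rw [φ.2.2.1, U.2, V.2]; rfl⟩, closure_mono ?_, closure_mono ?_⟩
      · intro x hx
        exact hx.1
      · intro x hx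
        exact hx.2
    · intro U
      refine Set.Nonempty.closure ?_
      rw [Set.nonempty_iff_ne_empty]
      intro he
      have h1 : U.1 = ⊥ := Heyting.Regular.coe_injective (Opens.ext he)
      have h2 := φ.2.2.2 ⊤
      rw [φ.2.1, compl_top, ← h1, U.2] at h2
      simp at h2
  obtain ⟨x, hx⟩ := hne
  exact ⟨x, fun U hU => Set.mem_iInter.1 hx ⟨U, hU⟩⟩

theorem ConvergesTo.unique [T2Space X] {φ : GleasonCover X} {x y : X} (hx : ConvergesTo φ x)
    (hy : ConvergesTo φ y) : x = y := by
  by_contra hne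
  obtain ⟨V, W, hV, hW, hxV, hyW, hVW⟩ := t2_separation hne
  have h1 : φ.1 (regularize ⟨V, hV⟩) = true := by
    apply hx.mem
    rw [carrier_regularize]
    exact interior_maximal subset_closure hV hxV
  have h2 := hy _ h1
  rw [carrier_regularize] at h2
  have h3 : y ∈ closure V := closure_minimal interior_subset isClosed_closure h2
  obtain ⟨z, hzW, hzV⟩ := mem_closure_iff.1 h3 W hW hyW
  exact Set.disjoint_left.1 hVW hzV hzW

/-- The Gleason map `g : X̂ → X`, sending an ultrafilter to its limit. -/
noncomputable def limit [CompactSpace X] (φ : GleasonCover X) : X :=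
  (exists_convergesTo φ).choose

theorem convergesTo_limit [CompactSpace X] (φ : GleasonCover X) : ConvergesTo φ (limit φ) :=
  (exists_convergesTo φ).choose_spec

theorem continuous_limit [CompactSpace X] [T2Space X] :
    Continuous (limit : GleasonCover X → X) := by
  rw [continuous_iff_continuousAt]
  intro φ N hN
  obtain ⟨C, hC, hCc, hCN⟩ := exists_mem_nhds_isClosed_subset hN
  let U : RegularOpens X := regularize ⟨interior C, isOpen_interior⟩
  have hφ : φ.1 U = true := by
    apply (convergesTo_limit φ).mem
    rw [carrier_regularize]
    exact interior_maximal subset_closure isOpen_interior (mem_interior_iff_mem_nhds.2 hC)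
  have hUC : closure (carrier U) ⊆ C := by
    rw [carrier_regularize]
    exact closure_minimal (interior_subset.trans (closure_minimal interior_subset hCc)) hCc
  have hcont : Continuous fun ψ : GleasonCover X => ψ.1 U :=
    (continuous_apply U).comp continuous_subtype_val
  have hopen : IsOpen {ψ : GleasonCover X | ψ.1 U = true} :=
    hcont.isOpen_preimage {true} (isOpen_discrete _)
  rw [Filter.mem_map]
  exact Filter.mem_of_superset (hopen.mem_nhds hφ)
    fun ψ hψ => hCN (hUC (convergesTo_limit ψ U hψ))

theorem limit_surjective [CompactSpace X] [T2Space X] :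
    Function.Surjective (limit : GleasonCover X → X) := by
  classical
  intro x
  -- an ultrafilter of subsets that converges to `x` and contains all dense open sets
  let D : Filter X :=
    { sets := {A | ∃ W : Set X, IsOpen W ∧ Dense W ∧ W ⊆ A}
      univ_sets := ⟨Set.univ, isOpen_univ, dense_univ, Set.Subset.rfl⟩
      sets_of_superset := fun ⟨W, h₁, h₂, h₃⟩ h => ⟨W, h₁, h₂, h₃.trans h⟩
      inter_sets := fun ⟨W, h₁, h₂, h₃⟩ ⟨W', h₁', h₂', h₃'⟩ =>
        ⟨W ∩ W', h₁.inter h₁', h₂.inter_of_isOpen_left h₂' h₁, Set.inter_subset_inter h₃ h₃'⟩ }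
  have hD : (nhds x ⊓ D).NeBot := by
    rw [Filter.inf_neBot_iff]
    rintro A hA B ⟨W, _, hW, hWB⟩
    obtain ⟨O, hOA, hO, hxO⟩ := mem_nhds_iff.1 hA
    obtain ⟨y, hy, hy'⟩ := hW.inter_open_nonempty O hO ⟨x, hxO⟩
    exact ⟨y, hOA hy, hWB hy'⟩
  let F : Ultrafilter X := Ultrafilter.of (nhds x ⊓ D)
  have hF : (F : Filter X) ≤ nhds x ⊓ D := Ultrafilter.of_le _
  have hdense : ∀ W : Set X, IsOpen W → Dense W → W ∈ F := fun W hW hW' =>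
    hF (Filter.mem_inf_of_right ⟨W, hW, hW', Set.Subset.rfl⟩)
  have hnhds : ∀ W ∈ nhds x, W ∈ F := fun W hW => hF (Filter.mem_inf_of_left hW)
  let φ : GleasonCover X := ⟨fun U => decide (carrier U ∈ F), by
    refine ⟨?_, ?_, ?_⟩
    · exact decide_eq_true (F : Filter X).univ_mem
    · intro U V
      have h : carrier (U ⊓ V) ∈ F ↔ carrier U ∈ F ∧ carrier V ∈ F :=
        Filter.inter_mem_iff (f := (F : Filter X))
      simp [h]
    · intro U
      have h : carrier Uᶜ ∈ F ↔ carrier U ∉ F := by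
        rw [carrier_compl]
        constructor
        · intro h1 h2
          obtain ⟨y, hy, hy'⟩ := F.nonempty_of_mem (Filter.inter_mem h1 h2)
          exact interior_subset hy hy'
        · intro h1
          have h2 : carrier U ∪ interior (carrier U)ᶜ ∈ F := by
            refine hdense _ (U.val.isOpen.union isOpen_interior) fun y => ?_
            rw [closure_union, interior_compl]
            by_cases hy : y ∈ closure (carrier U)
            · exact Or.inl hy
            · exact Or.inr (subset_closure hy)
          exact (Ultrafilter.union_mem_iff.1 h2).resolve_left h1
      simp [h]⟩
  refine ⟨φ, ((convergesTo_limit φ).unique ?_)⟩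
  intro U hU
  have hU' : carrier U ∈ F := by simpa [φ] using hU
  rw [mem_closure_iff_nhds]
  intro W hW
  exact F.nonempty_of_mem (Filter.inter_mem (hnhds W hW) hU')

end GleasonCover

/-- The object `𝒢 X = (X̂, E)`, where `x E y` iff `g x = g y`. -/
noncomputable def gleasonObj (X : KHausR.{u}) : StoneER.{u} where
  space := Profinite.of (GleasonCover X.space)
  setoid := Setoid.ker (GleasonCover.limit (X := X.space))
  isClosed_setoid :=
    isClosed_eq (GleasonCover.continuous_limit.comp continuous_fst)
      (GleasonCover.continuous_limit.comp continuous_snd)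

/-- The Gleason map `g : X̂ → X`. -/
noncomputable def gleasonMap (X : KHausR.{u}) : (gleasonObj X).space → X.space :=
  GleasonCover.limit (X := X.space)

theorem continuous_gleasonMap (X : KHausR.{u}) : Continuous (gleasonMap X) :=
  GleasonCover.continuous_limit

theorem gleasonMap_surjective (X : KHausR.{u}) : Function.Surjective (gleasonMap X) :=
  GleasonCover.limit_surjective

/-- The functor `𝒢`, sending `X` to `(X̂, E)` and a closed relation `R` from `X` to `X'` to
`g'˘ ∘ R ∘ g`, i.e. to the relation `{(x, x') | g x R g' x'}`. -/
noncomputable def gleasonFunctor : KHausR.{u} ⥤ StoneER.{u} where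
  obj X := gleasonObj X
  map {X Y} R :=
    { rel := {p | (gleasonMap X p.1, gleasonMap Y p.2) ∈ R.rel}
      isClosed_rel := R.isClosed_rel.preimage
        ((continuous_gleasonMap X).prodMap (continuous_gleasonMap Y))
      E_comp := by
        ext ⟨x, y⟩
        constructor
        · rintro ⟨z, h₁, h₂⟩
          have h₃ : gleasonMap X x = gleasonMap X z := h₁
          change (gleasonMap X x, gleasonMap Y y) ∈ R.rel
          rw [h₃]
          exact h₂
        · intro h
          exact ⟨x, (gleasonObj X).setoid.refl x, h⟩
      comp_E := by
        ext ⟨x, y⟩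
        constructor
        · rintro ⟨z, h₁, h₂⟩
          have h₃ : gleasonMap Y z = gleasonMap Y y := h₂
          change (gleasonMap X x, gleasonMap Y y) ∈ R.rel
          rw [← h₃]
          exact h₁
        · intro h
          exact ⟨y, h, (gleasonObj Y).setoid.refl y⟩ }
  map_id X := rfl
  map_comp {X Y Z} R S := by
    refine StoneER.Hom.ext ?_
    ext ⟨x, z⟩
    constructor
    · rintro ⟨p, h₁, h₂⟩
      obtain ⟨y, rfl⟩ := gleasonMap_surjective Y p
      exact ⟨y, h₁, h₂⟩
    · rintro ⟨y, h₁, h₂⟩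
      exact ⟨gleasonMap Y y, h₁, h₂⟩

/-! In `StoneER` the identity of `(X, E)` is `E` itself, so an object is determined up to
isomorphism by its quotient. A point of `X` and a point of another space over `X / E` can be related
when they have the same image in `X / E`; this closed relation composed with its converse is the
kernel relation on each side, i.e. the identity. Only surjectivity of the two maps to `X / E` is
used. Taking the Gleason map as the second one gives `gleasonObjQuotientIso`, hence `𝒢 ∘ 𝒬 ≅ id`.
For `𝒬 ∘ 𝒢 ≅ id`, the quotient of the Gleason cover by the kernel of `g` is the image of `g`, the
whole space (`gleasonQuotientIso`).

The topological content is that `𝒢 Y` is a Gleason space (`isGleasonSpace_gleasonObj`). It rests on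
three facts: the sets `basic U` form a clopen basis, a member of an ultrafilter is nonempty, and
every ultrafilter whose limit lies in `U` contains `U`. The last transfers points of `U` to points
of `basic U`, which yields irreducibility of `g` and, with surjectivity of `g`, extremal
disconnectedness. The inclusion of Gleason spaces is then essentially surjective, and it preserves
the allegory structure by definition. -/

namespace GleasonCover

/-! ### Topology of the Gleason cover -/

variable {X : Type u} [TopologicalSpace X]

/-- The basic clopen set of ultrafilters that contain `U`. -/
def basic (U : RegularOpens X) : Set (GleasonCover X) := {φ | φ.1 U = true}

theorem mem_basic {U : RegularOpens X} {φ : GleasonCover X} : φ ∈ basic U ↔ φ.1 U = true :=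
  Iff.rfl

theorem isClopen_basic (U : RegularOpens X) : IsClopen (basic U) :=
  (isClopen_discrete {true}).preimage ((continuous_apply U).comp continuous_subtype_val)

theorem basic_inf (U V : RegularOpens X) : basic (U ⊓ V) = basic U ∩ basic V := by
  ext φ
  simp only [Set.mem_inter_iff, mem_basic, φ.2.2.1, Bool.and_eq_true]

theorem basic_mono {U V : RegularOpens X} (h : U ≤ V) : basic U ⊆ basic V := by
  have h' : U ⊓ V = U := Heyting.Regular.coe_injective (inf_eq_left.2 h)
  rw [← h', basic_inf]
  exact Set.inter_subset_right

theorem mem_basic_finset_inf {ι : Type*} (s : Finset ι) (f : ι → RegularOpens X)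
    {φ : GleasonCover X} : φ ∈ basic (s.inf f) ↔ ∀ i ∈ s, φ ∈ basic (f i) := by
  classical
  induction s using Finset.induction_on with
  | empty => exact ⟨fun _ _ h => absurd h (Finset.notMem_empty _), fun _ => φ.2.1⟩
  | insert i s _ ih =>
    have h : basic ((insert i s).inf f) = basic (f i) ∩ basic (s.inf f) := by
      rw [Finset.inf_insert]
      exact basic_inf _ _
    rw [h, Set.mem_inter_iff, ih, Finset.forall_mem_insert]

/-- The sets `basic U` form a basis of the topology of the Gleason cover. -/
theorem exists_basic_subset {O : Set (GleasonCover X)} (hO : IsOpen O) {φ : GleasonCover X}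
    (hφ : φ ∈ O) : ∃ U, φ ∈ basic U ∧ basic U ⊆ O := by
  obtain ⟨O', hO', rfl⟩ := isOpen_induced_iff.1 hO
  obtain ⟨I, t, ht, hI⟩ := isOpen_pi_iff.1 hO' φ.1 hφ
  -- Complementing the regular opens outside `φ` makes each coordinate condition "`ψ` agrees with
  -- `φ` at `V`" a membership condition; the finitely many conditions of a product neighbourhood
  -- then combine into one meet.
  let f : RegularOpens X → RegularOpens X := fun V => if φ.1 V = true then V else Vᶜ
  have hf : ∀ (ψ : GleasonCover X) (V : RegularOpens X),
      ψ ∈ basic (f V) ↔ ψ.1 V = φ.1 V := by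
    intro ψ V
    by_cases h : φ.1 V = true
    · simp [f, h, mem_basic]
    · simp [f, h, mem_basic, ψ.2.2.2]
  refine ⟨I.inf f, (mem_basic_finset_inf I f).2 fun V _ => (hf φ V).2 rfl, fun ψ hψ => hI ?_⟩
  intro V hV
  rw [(hf ψ V).1 ((mem_basic_finset_inf I f).1 hψ V hV)]
  exact (ht V hV).2

/-- An ultrafilter contains `⊤`, hence not its complement `⊥`, the only regular open with empty
carrier. -/
theorem carrier_nonempty {U : RegularOpens X} {φ : GleasonCover X} (h : φ ∈ basic U) :
    (carrier U).Nonempty := by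
  rw [Set.nonempty_iff_ne_empty]
  intro he
  have h₁ : U = ⊥ := Heyting.Regular.coe_injective (Opens.ext he)
  have h₂ := φ.2.2.2 ⊤
  rw [φ.2.1, compl_top, ← h₁, mem_basic.1 h] at h₂
  simp at h₂

variable [CompactSpace X]

theorem mem_basic_of_limit_mem {U : RegularOpens X} {φ : GleasonCover X}
    (h : limit φ ∈ carrier U) : φ ∈ basic U :=
  (convergesTo_limit φ).mem h

/-- The Gleason map is irreducible: it sends proper closed subsets to proper closed subsets. -/
theorem limit_image_ne_univ {F : Set (GleasonCover X)} (hF : IsClosed F) (hne : F ≠ Set.univ) :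
    limit '' F ≠ Set.univ := by
  obtain ⟨φ, hφ⟩ := (Set.ne_univ_iff_exists_notMem F).1 hne
  obtain ⟨U, hU, hUF⟩ := exists_basic_subset hF.isOpen_compl hφ
  obtain ⟨x, hx⟩ := carrier_nonempty hU
  -- Any ultrafilter with limit `x ∈ U` lies in `basic U`, which misses `F`; so `x` has no preimage
  -- in `F`.
  refine (Set.ne_univ_iff_exists_notMem _).2 ⟨x, ?_⟩
  rintro ⟨ψ, hψ, rfl⟩
  exact hUF (mem_basic_of_limit_mem hx) hψ

variable [T2Space X]

/-- The Gleason cover is extremally disconnected. -/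
theorem extremallyDisconnected : ExtremallyDisconnected (GleasonCover X) where
  open_closure O hO := by
    -- The regular open generated by `W` is the supremum of all `U` with `basic U ⊆ O`; the closure
    -- of `O` turns out to be its clopen basic set, by completeness of the algebra of regular opens.
    let W : Opens X := ⟨⋃ U : {U : RegularOpens X // basic U ⊆ O}, carrier U.1,
      isOpen_iUnion fun U => U.1.val.isOpen⟩
    have hW : closure O = basic (regularize W) := by
      apply Set.Subset.antisymm
      · refine closure_minimal (fun φ hφ => ?_) (isClopen_basic _).isClosed
        obtain ⟨U, hU, hUO⟩ := exists_basic_subset hO hφ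
        refine basic_mono (fun x hx => ?_ : carrier U ⊆ carrier (regularize W)) hU
        rw [carrier_regularize]
        exact interior_maximal subset_closure W.isOpen (Set.mem_iUnion.2 ⟨⟨U, hUO⟩, hx⟩)
      · intro φ hφ
        rw [mem_closure_iff]
        intro N hN hφN
        obtain ⟨V, hV, hVN⟩ := exists_basic_subset hN hφN
        -- `V` meets `int (cl W)`, and, being open, meets `W` itself, hence some `U` with `basic U ⊆
        -- O`. Any ultrafilter over a common point of `V` and `U` lies in both `N` and `O`.
        have hVW : φ ∈ basic (V ⊓ regularize W) := by
          rw [basic_inf]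
          exact ⟨hV, hφ⟩
        obtain ⟨x, hxV, hxW⟩ := carrier_nonempty hVW
        have hxW' : x ∈ closure (W : Set X) := by
          have h : x ∈ carrier (regularize W) := hxW
          rw [carrier_regularize] at h
          exact interior_subset h
        obtain ⟨y, hyV, hyW⟩ := mem_closure_iff.1 hxW' _ V.val.isOpen hxV
        obtain ⟨⟨U, hUO⟩, hyU⟩ := Set.mem_iUnion.1 hyW
        obtain ⟨ψ, rfl⟩ := limit_surjective y
        exact ⟨ψ, hVN (mem_basic_of_limit_mem hyV), hUO (mem_basic_of_limit_mem hyU)⟩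
    rw [hW]
    exact (isClopen_basic _).isOpen

end GleasonCover

/-- Since `E` is the kernel of `g`, `E[F]` is the preimage of `g[F]`. It is closed by compactness,
and by surjectivity of `g` it can be everything only if `g[F]` is, which irreducibility of `g`
excludes. -/
theorem isGleasonSpace_gleasonObj (Y : KHausR.{u}) : IsGleasonSpace (gleasonObj Y) := by
  refine ⟨GleasonCover.extremallyDisconnected (X := Y.space), fun F hF hne => ?_⟩
  have h : (gleasonObj Y).E.image F = gleasonMap Y ⁻¹' (gleasonMap Y '' F) := by
    ext φ
    rfl
  rw [h]
  refine ⟨(hF.isCompact.image (continuous_gleasonMap Y)).isClosed.preimage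
    (continuous_gleasonMap Y), fun hu => ?_⟩
  refine GleasonCover.limit_image_ne_univ (X := Y.space) hF hne (Set.eq_univ_of_forall fun y => ?_)
  obtain ⟨φ, rfl⟩ := gleasonMap_surjective Y y
  exact hu.symm.subset (Set.mem_univ φ)

/-! ### The natural isomorphisms -/

/-- The isomorphism in `KHausR` given by two mutually converse closed relations. -/
def KHausR.isoOfHom {X Y : KHausR.{u}} (R : X ⟶ Y) (h₁ : R.rel ○ R.rel.inv = SetRel.id)
    (h₂ : R.rel.inv ○ R.rel = SetRel.id) : X ≅ Y where
  hom := R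
  inv := ⟨R.rel.inv, isClosed_setRel_inv R.isClosed_rel⟩
  hom_inv_id := KHausR.Hom.ext h₁
  inv_hom_id := KHausR.Hom.ext h₂

/-- The homeomorphism from the quotient `X̂ / E` to `X`, as a closed relation. -/
noncomputable def gleasonQuotientIso (Y : KHausR.{u}) : (gleasonObj Y).quotient ≅ Y :=
  KHausR.isoOfHom (X := (gleasonObj Y).quotient) (Y := Y)
    { rel := {p | ∃ φ, (gleasonObj Y).proj φ = p.1 ∧ gleasonMap Y φ = p.2}
      isClosed_rel := by
        -- The relation is the range of `(π, g)` on the compact space `X̂`.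
        have h := isCompact_range
          ((gleasonObj Y).continuous_proj.prodMk (continuous_gleasonMap Y))
        convert h.isClosed using 1
        ext ⟨p, y⟩
        simp [Prod.ext_iff] }
    (by
      ext ⟨p, q⟩
      constructor
      · rintro ⟨y, ⟨φ, rfl, h₁⟩, ψ, rfl, h₂⟩
        exact (gleasonObj Y).proj_eq_iff.2 (h₁.trans h₂.symm)
      · rintro (rfl : p = q)
        obtain ⟨φ, rfl⟩ := (gleasonObj Y).proj_surjective p
        exact ⟨_, ⟨φ, rfl, rfl⟩, φ, rfl, rfl⟩)
    (by
      ext ⟨y, z⟩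
      constructor
      · rintro ⟨p, ⟨φ, rfl, rfl⟩, ψ, h, rfl⟩
        exact ((gleasonObj Y).proj_eq_iff.1 h).symm
      · rintro (rfl : y = z)
        obtain ⟨φ, rfl⟩ := gleasonMap_surjective Y y
        exact ⟨_, ⟨φ, rfl, rfl⟩, φ, rfl, rfl⟩)

/-- The natural isomorphism `𝒬 ∘ 𝒢 ≅ id`. -/
noncomputable def gleasonCompQuotient :
    gleasonFunctor.{u} ⋙ quotientFunctor.{u} ≅ 𝟭 KHausR.{u} :=
  NatIso.ofComponents gleasonQuotientIso fun {Y Z} R => by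
    refine KHausR.Hom.ext ?_
    ext ⟨p, z⟩
    constructor
    · rintro ⟨_, ⟨φ, ψ, rfl, h, rfl⟩, ψ', h', rfl⟩
      have h₁ : gleasonMap Z ψ' = gleasonMap Z ψ := (gleasonObj Z).proj_eq_iff.1 h'
      refine ⟨gleasonMap Y φ, ⟨φ, rfl, rfl⟩, ?_⟩
      change (gleasonMap Y φ, gleasonMap Z ψ') ∈ R.rel
      rw [h₁]
      exact h
    · rintro ⟨_, ⟨φ, rfl, rfl⟩, h⟩
      obtain ⟨ψ, rfl⟩ := gleasonMap_surjective Z z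
      exact ⟨_, ⟨φ, ψ, rfl, h, rfl⟩, ψ, rfl, rfl⟩

/-- The isomorphism between `𝒢 (X / E)` and `(X, E)`, relating an ultrafilter to the points of the
equivalence class that is its limit. -/
noncomputable def gleasonObjQuotientIso (X : StoneER.{u}) : gleasonObj X.quotient ≅ X where
  hom :=
    { rel := {p | gleasonMap X.quotient p.1 = X.proj p.2}
      isClosed_rel := isClosed_eq ((continuous_gleasonMap _).comp continuous_fst)
        (X.continuous_proj.comp continuous_snd)
      E_comp := by
        ext ⟨φ, x⟩
        exact ⟨fun ⟨ψ, h₁, h₂⟩ => Eq.trans (b := gleasonMap X.quotient ψ) h₁ h₂,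
          fun h => ⟨φ, rfl, h⟩⟩
      comp_E := by
        ext ⟨φ, x⟩
        exact ⟨fun ⟨y, h₁, h₂⟩ => Eq.trans h₁ (X.proj_eq_iff.2 h₂),
          fun h => ⟨x, h, X.setoid.refl x⟩⟩ }
  inv :=
    { rel := {p | X.proj p.1 = gleasonMap X.quotient p.2}
      isClosed_rel := isClosed_eq (X.continuous_proj.comp continuous_fst)
        ((continuous_gleasonMap _).comp continuous_snd)
      E_comp := by
        ext ⟨x, φ⟩
        exact ⟨fun ⟨y, h₁, h₂⟩ => Eq.trans (X.proj_eq_iff.2 h₁) h₂,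
          fun h => ⟨x, X.setoid.refl x, h⟩⟩
      comp_E := by
        ext ⟨x, φ⟩
        exact ⟨fun ⟨ψ, h₁, h₂⟩ => Eq.trans (b := gleasonMap X.quotient ψ) h₁ h₂,
          fun h => ⟨φ, h, rfl⟩⟩ }
  hom_inv_id := by
    refine StoneER.Hom.ext ?_
    ext ⟨φ, ψ⟩
    constructor
    · rintro ⟨x, h₁, h₂⟩
      exact Eq.trans (b := X.proj x) h₁ h₂
    · intro h
      -- Any representative of the class `g φ` serves as intermediate point; the identity to be
      -- matched is the kernel of `g`, not equality.
      obtain ⟨x, hx⟩ := X.proj_surjective (gleasonMap X.quotient φ)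
      exact ⟨x, hx.symm, hx.trans h⟩
  inv_hom_id := by
    refine StoneER.Hom.ext ?_
    ext ⟨x, y⟩
    constructor
    · rintro ⟨φ, h₁, h₂⟩
      exact X.proj_eq_iff.1 (Eq.trans (b := gleasonMap X.quotient φ) h₁ h₂)
    · intro h
      obtain ⟨φ, hφ⟩ := gleasonMap_surjective X.quotient (X.proj x)
      exact ⟨φ, hφ.symm, hφ.trans (X.proj_eq_iff.2 h)⟩

/-- The natural isomorphism `𝒢 ∘ 𝒬 ≅ id`. -/
noncomputable def quotientCompGleason :
    quotientFunctor.{u} ⋙ gleasonFunctor.{u} ≅ 𝟭 StoneER.{u} :=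
  NatIso.ofComponents gleasonObjQuotientIso fun {X Y} R => by
    refine StoneER.Hom.ext ?_
    ext ⟨φ, y⟩
    constructor
    · rintro ⟨ψ, ⟨x, y', h₁, h, h₂⟩, h₃⟩
      -- `y'` and `y` are only equivalent; `R` absorbs the difference because it is saturated.
      exact ⟨x, h₁.symm, R.comp_E.subset ⟨y', h, Y.proj_eq_iff.1 (h₂.trans h₃)⟩⟩
    · rintro ⟨x, h₁, h⟩
      obtain ⟨ψ, hψ⟩ := gleasonMap_surjective Y.quotient (Y.proj y)
      exact ⟨ψ, ⟨x, y, h₁.symm, h, hψ.symm⟩, hψ⟩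

/-! ### Restriction to Gleason spaces -/

/-- Fullness of the subcategory lets the isomorphisms already built be reused unchanged, with their
naturality. -/
theorem isQuasiInverse_gleasonFunctor_lift :
    IsQuasiInverse (IsGleasonSpace.{u}.lift gleasonFunctor.{u} isGleasonSpace_gleasonObj)
      (IsGleasonSpace.{u}.ι ⋙ quotientFunctor.{u}) :=
  ⟨⟨NatIso.ofComponents
      (fun X => IsGleasonSpace.isoMk (quotientCompGleason.app X.obj))
      fun f => IsGleasonSpace.hom_ext (quotientCompGleason.hom.naturality f.hom)⟩,
    ⟨NatIso.ofComponents (fun Y => gleasonCompQuotient.app Y)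
      fun f => gleasonCompQuotient.hom.naturality f⟩⟩

theorem isAllegoryEquivalence_gleason_ι :
    IsAllegoryEquivalence (IsGleasonSpace.{u}.ι : GleR.{u} ⥤ StoneER.{u}) where
  isAllegoryMorphism := ⟨fun _ _ => rfl, fun _ => rfl⟩
  isEquivalence :=
    -- Fullness and faithfulness are automatic for a full subcategory; only essential surjectivity
    -- needs the Gleason cover.
    { essSurj := ⟨fun X => ⟨⟨gleasonObj X.quotient, isGleasonSpace_gleasonObj _⟩,
        ⟨gleasonObjQuotientIso X⟩⟩⟩ }

theorem mainTheorem10 :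
    -- every object `(X, E)` is isomorphic to the Gleason space `𝒢 (X / E)`
    (∀ X : StoneER.{u},
      IsGleasonSpace (gleasonFunctor.obj (quotientFunctor.obj X)) ∧
        Nonempty (X ≅ gleasonFunctor.obj (quotientFunctor.obj X))) ∧
    -- `𝒢` is a quasi-inverse of `𝒬`
    IsQuasiInverse gleasonFunctor.{u} quotientFunctor.{u} ∧
    -- `𝒢` takes values in Gleason spaces, and is then a quasi-inverse of the restriction of `𝒬`
    (∃ h : ∀ Y : KHausR.{u}, IsGleasonSpace (gleasonFunctor.obj Y),
      IsQuasiInverse (IsGleasonSpace.{u}.lift gleasonFunctor.{u} h)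
        (IsGleasonSpace.{u}.ι ⋙ quotientFunctor.{u})) ∧
    -- the inclusion of Gleason spaces is an equivalence of allegories
    IsAllegoryEquivalence (IsGleasonSpace.{u}.ι : GleR.{u} ⥤ StoneER.{u}) := by
  exact ⟨fun X => ⟨isGleasonSpace_gleasonObj _, ⟨(gleasonObjQuotientIso X).symm⟩⟩,
    ⟨⟨quotientCompGleason⟩, ⟨gleasonCompQuotient⟩⟩,
    ⟨isGleasonSpace_gleasonObj, isQuasiInverse_gleasonFunctor_lift⟩,
    isAllegoryEquivalence_gleason_ι⟩
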